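/- Let $X$ be a Peano continuum, i.e. a nonempty, compact, connected, locally connected metrizable space (a one-point space is allowed), with a compatible metric $d$. Let $\operatorname{Cont}(X)$ be the hyperspace of all nonempty compact connected subsets of $X$, with the Vietoris topology (equivalently, the topology of the Hausdorff distance). A continuum $K \in \operatorname{Cont}(X)$ is called tree-like if for every $\varepsilon > 0$ there are finitely many relatively open subsets $U_1,\dots,U_n$ of $K$, each of diameter smaller than $\varepsilon$, that cover $K$ and whose nerve is a tree; here the nerve is the graph with vertices $v_1,\dots,v_n$ in which, for $i \neq j$, $v_i$ and $v_j$ are adjacent if and only if $U_i \cap U_j \neq \emptyset$. Then the set of all tree-like $K \in \operatorname{Cont}(X)$ is comeager in $\operatorname{Cont}(X)$; moreover, it is a dense $G_\delta$ subset of $\operatorname{Cont}(X)$. -/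

import Mathlib

/-- The hyperspace `Cont(X)` of all (nonempty, compact, connected) subcontinua of `X`, with the
subspace topology inherited from the Vietoris topology on the nonempty compact subsets of `X`
(for metric `X` this is the topology of the Hausdorff distance). -/
abbrev Subcontinua (X : Type*) [TopologicalSpace X] : Type _ :=
  {K : TopologicalSpace.NonemptyCompacts X // IsConnected (K : Set X)}

/-- The nerve of a family of sets: the graph on the index set in which two distinct indices are
joined by an edge exactly when the corresponding sets meet. -/
def nerveGraph {ι Y : Type*} (U : ι → Set Y) : SimpleGraph ι where
  Adj i j := i ≠ j ∧ (U i ∩ U j).Nonempty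
  symm := ⟨fun _ _ h => ⟨h.1.symm, by rw [Set.inter_comm]; exact h.2⟩⟩
  loopless := ⟨fun _ h => h.1 rfl⟩

/-- A metric continuum `Y` is tree-like if for every `ε > 0` it has a finite open cover
`U₁, …, Uₙ` of mesh smaller than `ε` whose nerve is a tree. -/
def IsTreeLike (Y : Type*) [MetricSpace Y] : Prop :=
  ∀ ε : ℝ, 0 < ε → ∃ (n : ℕ) (U : Fin n → Set Y),
    (∀ i, IsOpen (U i)) ∧ (⋃ i, U i) = Set.univ ∧
    (∀ i, Metric.ediam (U i) < ENNReal.ofReal ε) ∧ (nerveGraph U).IsTree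

/-! Tree-likeness is the conjunction over `n` of `HasForestCover` for mesh 1/(n+1). Only acyclicity
of the nerve needs care: a connected `K` forces connectedness once members missing `K` are dropped.
Each condition is open, since a cover of `K` by open sets of `X` also covers all nearby continua.
For density, a basic Vietoris neighbourhood of `K` only asks for a continuum inside an open set that
meets finitely many others, so it suffices to join finitely many points of a connected open set, one
at a time (`HasForestCover.exists_insert`). A simple chain of small connected open sets runs from
the current continuum to the new point; after the old cover is shrunk, the chain hangs on its nerve
as a path attached at no more than one vertex, which creates no cycle. Baire category in the compact
hyperspace finishes the proof. -/

open Set Topology TopologicalSpace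

/-! ### Acyclic graphs and nerves of covers -/

namespace SimpleGraph

/-- Adding a vertex with at most one neighbour to an acyclic graph yields an acyclic graph. -/
theorem isAcyclic_of_leaf {V : Type*} {G : SimpleGraph V} (v : V)
    (hv : ∀ a b, G.Adj v a → G.Adj v b → a = b) (h : (G.induce {v}ᶜ).IsAcyclic) :
    G.IsAcyclic := by
  classical
  intro u c hc
  by_cases hmem : v ∈ c.support
  · have hc' := hc.rotate hmem
    exact hc'.snd_ne_penultimate
      (hv _ _ (SimpleGraph.Walk.adj_snd hc'.not_nil)
        (SimpleGraph.Walk.adj_penultimate hc'.not_nil).symm)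
  · have hw : ∀ x ∈ c.support, x ∈ ({v}ᶜ : Set V) := by
      intro x hx hxv
      exact hmem (by simpa using hxv ▸ hx)
    refine h (c.induce _ hw) ?_
    rw [← c.map_induce hw] at hc
    exact hc.of_map

end SimpleGraph

section Nerve

variable {ι Y : Type*}

theorem nerveGraph_mono {U W : ι → Set Y} (h : ∀ i, U i ⊆ W i) : nerveGraph U ≤ nerveGraph W :=
  fun _ _ hij => ⟨hij.1, hij.2.mono (inter_subset_inter (h _) (h _))⟩

/-- Adding a set which meets at most one member of a family with acyclic nerve keeps the nerve
acyclic. -/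
theorem isAcyclic_nerveGraph_option {U : ι → Set Y} (hU : (nerveGraph U).IsAcyclic) {D : Set Y}
    (i : ι) (hD : ∀ j, j ≠ i → Disjoint D (U j)) :
    (nerveGraph (fun o : Option ι => o.elim D U)).IsAcyclic := by
  have key : ∀ a, (nerveGraph (fun o : Option ι => o.elim D U)).Adj none a → a = some i := by
    rintro (_ | a) h
    · exact absurd rfl h.1
    · by_contra hne
      exact not_disjoint_iff_nonempty_inter.2 h.2 (hD a (fun e => hne (e ▸ rfl)))
  refine SimpleGraph.isAcyclic_of_leaf none
    (fun a b ha hb => (key a ha).trans (key b hb).symm) ?_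
  have hs : ∀ a : ({none}ᶜ : Set (Option ι)), ∃ j, a.1 = some j := by
    rintro ⟨_ | j, hj⟩
    · exact absurd rfl hj
    · exact ⟨j, rfl⟩
  choose f hf using hs
  refine hU.comap ⟨f, ?_⟩ ?_
  · rintro a b ⟨hne, hab⟩
    refine ⟨fun e => hne ((hf a).trans ((congrArg some e).trans (hf b).symm)), ?_⟩
    simpa [hf] using hab
  · intro a b hab
    apply Subtype.ext
    rw [hf a, hf b]
    exact congrArg some hab

/-- The members reachable from `i` and the remaining ones would have unions that separate the space.
-/
theorem preconnected_nerveGraph [TopologicalSpace Y] [PreconnectedSpace Y] {U : ι → Set Y}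
    (ho : ∀ i, IsOpen (U i)) (hne : ∀ i, (U i).Nonempty) (hc : ⋃ i, U i = univ) :
    (nerveGraph U).Preconnected := by
  intro i j
  set A : Set Y := ⋃ k ∈ {k | (nerveGraph U).Reachable i k}, U k
  set B : Set Y := ⋃ k ∈ {k | ¬ (nerveGraph U).Reachable i k}, U k
  have hAo : IsOpen A := isOpen_biUnion fun k _ => ho k
  have hBo : IsOpen B := isOpen_biUnion fun k _ => ho k
  have hAB : Disjoint A B := by
    rw [Set.disjoint_left]
    intro y hyA hyB
    simp only [A, B, mem_iUnion, mem_ofPred_eq, exists_prop] at hyA hyB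
    obtain ⟨k, hk, hyk⟩ := hyA
    obtain ⟨l, hl, hyl⟩ := hyB
    rcases eq_or_ne k l with rfl | hkl
    · exact hl hk
    · exact hl (hk.trans (SimpleGraph.Adj.reachable ⟨hkl, y, hyk, hyl⟩))
  have hcov : (univ : Set Y) ⊆ A ∪ B := by
    rw [← hc]
    refine iUnion_subset fun k y hy => ?_
    by_cases hk : (nerveGraph U).Reachable i k
    · exact .inl (mem_biUnion (x := k) hk hy)
    · exact .inr (mem_biUnion (x := k) hk hy)
  obtain ⟨x, hx⟩ := hne i
  have hsub := isPreconnected_univ.subset_left_of_subset_union hAo hBo hAB hcov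
    ⟨x, trivial, mem_biUnion (x := i) (SimpleGraph.Reachable.refl i) hx⟩
  obtain ⟨y, hy⟩ := hne j
  by_contra hj
  exact Set.disjoint_left.1 hAB (hsub (mem_univ y)) (mem_biUnion (x := j) hj hy)

end Nerve

/-! ### Small connected sets and continua in locally connected spaces -/

section LocallyConnected

variable {X : Type*} [TopologicalSpace X] [LocallyConnectedSpace X] [RegularSpace X]

theorem IsOpen.exists_isConnected_closure_subset {O : Set X} (hO : IsOpen O) {x : X} (hx : x ∈ O) :
    ∃ D, IsOpen D ∧ IsConnected D ∧ x ∈ D ∧ closure D ⊆ O := by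
  obtain ⟨t, ht, htc, htO⟩ := exists_mem_nhds_isClosed_subset (hO.mem_nhds hx)
  have hx' : x ∈ interior t := mem_interior_iff_mem_nhds.2 ht
  exact ⟨connectedComponentIn (interior t) x, isOpen_interior.connectedComponentIn,
    isConnected_connectedComponentIn_iff.2 hx', mem_connectedComponentIn hx',
    (closure_minimal ((connectedComponentIn_subset _ _).trans interior_subset) htc).trans htO⟩

/-- Two points of a connected open set in a compact locally connected space lie in a continuum
contained in that set. -/
theorem IsOpen.exists_continuum_subset [CompactSpace X] {W : Set X} (hW : IsOpen W)
    (hWc : IsPreconnected W) {x y : X} (hx : x ∈ W) (hy : y ∈ W) :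
    ∃ L, IsCompact L ∧ IsConnected L ∧ x ∈ L ∧ y ∈ L ∧ L ⊆ W := by
  set R : Set X := {y | ∃ L, IsCompact L ∧ IsConnected L ∧ x ∈ L ∧ y ∈ L ∧ L ⊆ W}
  have key : ∀ D, IsConnected D → closure D ⊆ W → (D ∩ R).Nonempty → D ⊆ R := by
    rintro D hD hDW ⟨a, haD, L, hL, hLc, hxL, haL, hLW⟩ b hb
    exact ⟨L ∪ closure D, hL.union isClosed_closure.isCompact,
      hLc.union ⟨a, haL, subset_closure haD⟩ hD.closure, .inl hxL, .inr (subset_closure hb),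
      union_subset hLW hDW⟩
  have hRo : IsOpen R := by
    rw [isOpen_iff_mem_nhds]
    rintro a ha
    have haW : a ∈ W := by
      obtain ⟨L, -, -, -, haL, hLW⟩ := ha
      exact hLW haL
    obtain ⟨D, hDo, hDc, haD, hDW⟩ := hW.exists_isConnected_closure_subset haW
    exact Filter.mem_of_superset (hDo.mem_nhds haD) (key D hDc hDW ⟨a, haD, ha⟩)
  have hxR : x ∈ R := ⟨{x}, isCompact_singleton, isConnected_singleton, rfl, rfl, by simpa⟩
  -- `R` is open and relatively closed in the connected set `W`.
  refine hWc.subset_of_closure_inter_subset hRo ⟨x, hx, hxR⟩ ?_ hy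
  rintro a ⟨haR, haW⟩
  obtain ⟨D, hDo, hDc, haD, hDW⟩ := hW.exists_isConnected_closure_subset haW
  exact key D hDc hDW (mem_closure_iff.1 haR D hDo haD) haD

end LocallyConnected

/-! ### Simple chains of open sets -/

section Chain

variable {X : Type*}

/-- A simple chain of sets, listed from its last link to its first link `D₀`: each further link
belongs to `𝒟`, meets its predecessor, and misses all other earlier links. -/
inductive IsSimpleChain (𝒟 : Set (Set X)) (D₀ : Set X) : List (Set X) → Prop
  | single : IsSimpleChain 𝒟 D₀ [D₀]
  | cons {D E : Set X} {l : List (Set X)} (h : IsSimpleChain 𝒟 D₀ (E :: l)) (hD : D ∈ 𝒟)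
      (hDE : (D ∩ E).Nonempty) (hl : ∀ F ∈ l, Disjoint D F) : IsSimpleChain 𝒟 D₀ (D :: E :: l)

namespace IsSimpleChain

variable {𝒟 : Set (Set X)} {D₀ : Set X} {l : List (Set X)}

theorem mem_or_eq (h : IsSimpleChain 𝒟 D₀ l) : ∀ F ∈ l, F = D₀ ∨ F ∈ 𝒟 := by
  induction h with
  | single => simp
  | cons h hD hDE hl ih =>
    intro F hF
    rcases List.mem_cons.1 hF with rfl | hF
    · exact .inr hD
    · exact ih F hF

theorem first_mem (h : IsSimpleChain 𝒟 D₀ l) : D₀ ∈ l := by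
  induction h with
  | single => simp
  | cons h hD hDE hl ih => exact List.mem_cons_of_mem _ ih

/-- A set meeting some link of a simple chain becomes the last link of a simple chain. -/
theorem exists_cons (h : IsSimpleChain 𝒟 D₀ l) {D : Set X} (hD : D ∈ 𝒟)
    (hDl : ∃ F ∈ l, (D ∩ F).Nonempty) : ∃ l', IsSimpleChain 𝒟 D₀ (D :: l') := by
  induction h with
  | single =>
    obtain ⟨F, hF, hDF⟩ := hDl
    rw [List.mem_singleton.1 hF] at hDF
    exact ⟨_, .cons .single hD hDF (by simp)⟩
  | @cons E E' l h hE hEE' hl ih =>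
    -- If `D` already meets an earlier link, the last link is discarded; this keeps the chain
    -- simple.
    by_cases hex : ∃ F ∈ E' :: l, (D ∩ F).Nonempty
    · exact ih hex
    · obtain ⟨F, hF, hDF⟩ := hDl
      rcases List.mem_cons.1 hF with rfl | hF
      · refine ⟨_, .cons (.cons h hE hEE' hl) hD hDF fun F' hF' => ?_⟩
        by_contra hd
        exact hex ⟨F', hF', not_disjoint_iff_nonempty_inter.1 hd⟩
      · exact absurd ⟨F, hF, hDF⟩ hex

theorem isConnected_sUnion [TopologicalSpace X] (h : IsSimpleChain 𝒟 D₀ l)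
    (hl : ∀ F ∈ l, IsConnected F) : IsConnected (⋃₀ {F | F ∈ l}) := by
  induction h with
  | single => simpa using hl
  | @cons D E l h hD hDE hDl ih =>
    have heq : ⋃₀ {F | F ∈ D :: E :: l} = D ∪ ⋃₀ {F | F ∈ E :: l} := by
      ext x
      simp
    rw [heq]
    obtain ⟨x, hxD, hxE⟩ := hDE
    exact (hl D (by simp)).union ⟨x, hxD, E, by simp, hxE⟩
      (ih fun F hF => hl F (List.mem_cons_of_mem _ hF))

/-- Points of a connected open set `V` are reached by simple chains starting at a closed set. -/
theorem exists_of_isPreconnected [TopologicalSpace X] {𝒮 : Set (Set X)} {V K : Set X}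
    (hV : IsPreconnected V) (hVK : (V ∩ K).Nonempty)
    (h𝒮o : ∀ D ∈ 𝒮, IsOpen D) (h𝒟o : ∀ D ∈ 𝒟, IsOpen D)
    (h𝒮 : ∀ x ∈ V ∩ K, ∃ D ∈ 𝒮, x ∈ D) (h𝒟 : ∀ x ∈ V \ K, ∃ D ∈ 𝒟, x ∈ D) {z : X} (hz : z ∈ V) :
    ∃ D₀ ∈ 𝒮, ∃ E l, IsSimpleChain 𝒟 D₀ (E :: l) ∧ z ∈ E := by
  set R : Set X := {z | ∃ D₀ ∈ 𝒮, ∃ E l, IsSimpleChain 𝒟 D₀ (E :: l) ∧ z ∈ E}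
  have hRo : IsOpen R := by
    rw [isOpen_iff_mem_nhds]
    rintro a ⟨D₀, hD₀, E, l, hl, haE⟩
    have hE : IsOpen E := by
      rcases hl.mem_or_eq E (by simp) with rfl | hE
      exacts [h𝒮o _ hD₀, h𝒟o _ hE]
    exact Filter.mem_of_superset (hE.mem_nhds haE) fun b hb => ⟨D₀, hD₀, E, l, hl, hb⟩
  have hKR : V ∩ K ⊆ R := by
    intro x hx
    obtain ⟨D, hD, hxD⟩ := h𝒮 x hx
    exact ⟨D, hD, D, [], .single, hxD⟩
  obtain ⟨p, hp⟩ := hVK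
  refine hV.subset_of_closure_inter_subset hRo ⟨p, hp.1, hKR hp⟩ ?_ hz
  rintro a ⟨haR, haV⟩
  by_cases haK : a ∈ K
  · exact hKR ⟨haV, haK⟩
  obtain ⟨D, hD, haD⟩ := h𝒟 a ⟨haV, haK⟩
  obtain ⟨b, hbD, D₀, hD₀, E, l, hl, hbE⟩ := mem_closure_iff.1 haR D (h𝒟o D hD) haD
  obtain ⟨l', hl'⟩ := hl.exists_cons hD ⟨E, by simp, b, hbD, hbE⟩
  exact ⟨D₀, hD₀, D, l', hl', haD⟩

/-- Attaching a simple chain to a family with acyclic nerve: only the first link may meet members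
of the family. -/
theorem exists_isAcyclic {ι : Type} [Finite ι] {U : ι → Set X} {G : Set X} {P : Set X → Prop}
    (h : IsSimpleChain 𝒟 D₀ l) (hU : (nerveGraph (fun o : Option ι => o.elim D₀ U)).IsAcyclic)
    (hUG : ∀ j, Disjoint G (U j)) (hlG : ∀ F ∈ l, F ∈ 𝒟 → F ⊆ G) (hPU : ∀ j, P (U j))
    (hPl : ∀ F ∈ l, P F) :
    ∃ (κ : Type) (_ : Finite κ) (W : κ → Set X), (nerveGraph W).IsAcyclic ∧ (∀ k, P (W k)) ∧
      (∀ j, ∃ k, W k = U j) ∧ (∀ F ∈ l, ∃ k, W k = F) ∧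
      ∃ k₀, l.head? = some (W k₀) ∧
        ∀ D ⊆ G, (∀ F ∈ l.tail, Disjoint D F) → ∀ k, k ≠ k₀ → Disjoint D (W k) := by
  -- The final clause drives the induction: the next link lies in `G` and misses all links but the
  -- last, so it can meet only `W k₀` and enters the nerve as a leaf.
  induction h with
  | single =>
    refine ⟨Option ι, inferInstance, _, hU, ?_, fun j => ⟨some j, rfl⟩, ?_, none, rfl, ?_⟩
    · rintro (_ | j)
      exacts [hPl D₀ (by simp), hPU j]
    · intro F hF
      exact ⟨none, (List.mem_singleton.1 hF).symm⟩
    · rintro D hD - (_ | j) hj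
      exacts [absurd rfl hj, (hUG j).mono_left hD]
  | @cons D E l h hD hDE hDl ih =>
    obtain ⟨κ, _, W, hW, hPW, hWU, hWl, k₀, hk₀, hG⟩ :=
      ih (fun F hF => hlG F (List.mem_cons_of_mem _ hF))
        (fun F hF => hPl F (List.mem_cons_of_mem _ hF))
    have hk₀' : E = W k₀ := by simpa using hk₀
    refine ⟨Option κ, inferInstance, fun o => o.elim D W,
      isAcyclic_nerveGraph_option hW k₀ (hG D (hlG D (by simp) hD) hDl), ?_, ?_, ?_, none, rfl, ?_⟩
    · rintro (_ | j)
      exacts [hPl D (by simp), hPW j]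
    · intro j
      obtain ⟨k, hk⟩ := hWU j
      exact ⟨some k, hk⟩
    · intro F hF
      rcases List.mem_cons.1 hF with rfl | hF
      · exact ⟨none, rfl⟩
      · obtain ⟨k, hk⟩ := hWl F hF
        exact ⟨some k, hk⟩
    · rintro F hF hFl (_ | k) hk
      · exact absurd rfl hk
      · by_cases hkk : k = k₀
        · subst hkk
          exact hk₀'.subst (motive := fun A => Disjoint F A) (hFl E (by simp))
        · exact hG F hF (fun F' hF' => hFl F' (by simp_all)) k hkk

end IsSimpleChain

end Chain

/-! ### Covers with acyclic nerve -/

section ForestCover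

variable {X : Type*} [MetricSpace X]

/-- `K` is covered by a finite family of open sets of diameter less than `ε` with acyclic nerve. -/
def HasForestCover (K : Set X) (ε : ENNReal) : Prop :=
  ∃ (ι : Type) (_ : Finite ι) (U : ι → Set X), (∀ i, IsOpen (U i)) ∧ K ⊆ ⋃ i, U i ∧
    (∀ i, Metric.ediam (U i) < ε) ∧ (nerveGraph U).IsAcyclic

theorem exists_isOpen_ediam_lt (x : X) {ε : ENNReal} (hε : 0 < ε) :
    ∃ O, IsOpen O ∧ x ∈ O ∧ Metric.ediam O < ε := by
  obtain ⟨δ, hδ, hδε⟩ := exists_between hε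
  refine ⟨Metric.eball x (δ / 2), Metric.isOpen_eball,
    Metric.mem_eball_self (ENNReal.half_pos hδ.ne'), ?_⟩
  refine lt_of_le_of_lt (Metric.ediam_eball_le) ?_
  rwa [ENNReal.mul_div_cancel (by simp) (by simp)]

theorem hasForestCover_singleton (x : X) {ε : ENNReal} (hε : 0 < ε) : HasForestCover {x} ε := by
  obtain ⟨O, hO, hxO, hd⟩ := exists_isOpen_ediam_lt x hε
  exact ⟨Unit, inferInstance, fun _ => O, fun _ => hO, by simpa [iUnion_const] using hxO,
    fun _ => hd, .of_subsingleton⟩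

/-- The chain's first link `D₀` has closure in a single `U i`, and the closures of the later links
miss `K`. Hence the old cover can be cut away from the later links, and its members other than `U i`
from `D₀`, without uncovering any point of `K`. -/
theorem HasForestCover.exists_insert [CompactSpace X] [LocallyConnectedSpace X] {K V : Set X}
    {ε : ENNReal} (h : HasForestCover K ε) (hε : 0 < ε) (hK : IsCompact K) (hKc : IsConnected K)
    (hV : IsOpen V) (hVc : IsPreconnected V) (hKV : K ⊆ V) {z : X} (hz : z ∈ V) :
    ∃ K', IsCompact K' ∧ IsConnected K' ∧ K ⊆ K' ∧ z ∈ K' ∧ K' ⊆ V ∧ HasForestCover K' ε := by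
  classical
  obtain ⟨ι, _, U, hUo, hKU, hUε, hUa⟩ := h
  set 𝒮 : Set (Set X) := {D | IsOpen D ∧ IsConnected D ∧ (D ∩ K).Nonempty ∧ D ⊆ V ∧
    ∃ i, closure D ⊆ U i} with h𝒮
  set 𝒟 : Set (Set X) := {D | IsOpen D ∧ IsConnected D ∧ closure D ⊆ V \ K ∧
    Metric.ediam D < ε} with h𝒟
  obtain ⟨D₀, ⟨hD₀o, hD₀c, ⟨p, hpD₀, hpK⟩, hD₀V, i, hD₀i⟩, E, l, hl, hzE⟩ :=
    IsSimpleChain.exists_of_isPreconnected (𝒮 := 𝒮) (𝒟 := 𝒟) (K := K) hVc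
      (hKc.nonempty.mono fun x hx => ⟨hKV hx, hx⟩) (fun D hD => hD.1) (fun D hD => hD.1)
      (by
        rintro x ⟨hxV, hxK⟩
        obtain ⟨i, hi⟩ := mem_iUnion.1 (hKU hxK)
        obtain ⟨D, hDo, hDc, hxD, hD⟩ :=
          (hV.inter (hUo i)).exists_isConnected_closure_subset ⟨hxV, hi⟩
        exact ⟨D, ⟨hDo, hDc, ⟨x, hxD, hxK⟩, fun y hy => (hD (subset_closure hy)).1, i,
          fun y hy => (hD hy).2⟩, hxD⟩)
      (by
        rintro x ⟨hxV, hxK⟩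
        obtain ⟨O, hO, hxO, hOd⟩ := exists_isOpen_ediam_lt x hε
        obtain ⟨D, hDo, hDc, hxD, hD⟩ :=
          ((hV.sdiff hK.isClosed).inter hO).exists_isConnected_closure_subset ⟨⟨hxV, hxK⟩, hxO⟩
        exact ⟨D, ⟨hDo, hDc, fun y hy => (hD hy).1, lt_of_le_of_lt
          (Metric.ediam_mono fun y hy => (hD (subset_closure hy)).2) hOd⟩, hxD⟩) hz
  set c := E :: l
  have hc : ∀ F ∈ c, IsOpen F ∧ IsConnected F ∧ F ⊆ V ∧ Metric.ediam F < ε := by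
    intro F hF
    rcases hl.mem_or_eq F hF with rfl | hF
    · exact ⟨hD₀o, hD₀c, hD₀V,
        lt_of_le_of_lt (Metric.ediam_mono (subset_closure.trans hD₀i)) (hUε i)⟩
    · exact ⟨hF.1, hF.2.1, fun y hy => (hF.2.2.1 (subset_closure hy)).1, hF.2.2.2⟩
  -- The union of the chain is only open; `L` is a continuum inside it from `p ∈ K` to `z`.
  obtain ⟨L, hL, hLc, hpL, hzL, hLW⟩ :=
    (isOpen_sUnion fun F hF => (hc F hF).1 : IsOpen (⋃₀ {F | F ∈ c})).exists_continuum_subset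
      (hl.isConnected_sUnion fun F hF => (hc F hF).2.1).isPreconnected
      (x := p) (y := z) ⟨D₀, hl.first_mem, hpD₀⟩ ⟨E, by simp [c], hzE⟩
  set G : Set X := ⋃ F ∈ {F | F ∈ c ∧ F ∈ 𝒟}, closure F with hG
  have hfin : {F | F ∈ c ∧ F ∈ 𝒟}.Finite := (List.finite_toSet c).subset fun F hF => hF.1
  have hGc : IsClosed G := hfin.isClosed_biUnion fun F _ => isClosed_closure
  have hGK : Disjoint G K := by
    rw [Set.disjoint_left]
    intro x hx hxK
    obtain ⟨F, hF, hxF⟩ := mem_iUnion₂.1 hx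
    exact (hF.2.2.2.1 hxF).2 hxK
  -- Points of `K` in `closure D₀` stay covered by `B i`, the others by any `B j` with `U j`
  -- containing them.
  set B : ι → Set X := fun j => (U j \ G) \ (if j = i then ∅ else closure D₀) with hB
  have hBU : ∀ j, B j ⊆ U j := fun j x hx => hx.1.1
  have hBo : ∀ j, IsOpen (B j) := by
    intro j
    refine ((hUo j).sdiff hGc).sdiff ?_
    split_ifs
    exacts [isClosed_empty, isClosed_closure]
  have hBa : (nerveGraph (fun o : Option ι => o.elim D₀ B)).IsAcyclic := by
    refine isAcyclic_nerveGraph_option (hUa.anti (nerveGraph_mono hBU)) i fun j hj => ?_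
    rw [Set.disjoint_left]
    intro x hx hxB
    have := hxB.2
    rw [if_neg hj] at this
    exact this (subset_closure hx)
  obtain ⟨κ, hκ, W, hWa, hWP, hWB, hWc, -⟩ := hl.exists_isAcyclic (U := B) (G := G)
    (P := fun F => IsOpen F ∧ Metric.ediam F < ε) hBa
    (fun j => Set.disjoint_left.2 fun x hx hxB => hxB.1.2 hx)
    (fun F hF hF𝒟 x hx => mem_biUnion (x := F) ⟨hF, hF𝒟⟩ (subset_closure hx))
    (fun j => ⟨hBo j, lt_of_le_of_lt (Metric.ediam_mono (hBU j)) (hUε j)⟩)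
    (fun F hF => ⟨(hc F hF).1, (hc F hF).2.2.2⟩)
  refine ⟨K ∪ L, hK.union hL, hKc.union ⟨p, hpK, hpL⟩ hLc, subset_union_left, .inr hzL,
    union_subset hKV ?_, κ, hκ, W, fun k => (hWP k).1, union_subset ?_ ?_, fun k => (hWP k).2, hWa⟩
  · intro x hx
    obtain ⟨F, hF, hxF⟩ := hLW hx
    exact (hc F hF).2.2.1 hxF
  · intro x hx
    have hxG : x ∉ G := Set.disjoint_right.1 hGK hx
    have : ∃ j, x ∈ B j := by
      by_cases hxD : x ∈ closure D₀
      · exact ⟨i, ⟨hD₀i hxD, hxG⟩, by simp⟩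
      · obtain ⟨j, hj⟩ := mem_iUnion.1 (hKU hx)
        refine ⟨j, ⟨hj, hxG⟩, ?_⟩
        split_ifs
        exacts [id, hxD]
    obtain ⟨j, hj⟩ := this
    obtain ⟨k, hk⟩ := hWB j
    exact mem_iUnion.2 ⟨k, hk ▸ hj⟩
  · intro x hx
    obtain ⟨F, hF, hxF⟩ := hLW hx
    obtain ⟨k, hk⟩ := hWc F hF
    exact mem_iUnion.2 ⟨k, hk ▸ hxF⟩

theorem exists_continuum_hasForestCover [CompactSpace X] [LocallyConnectedSpace X] {V : Set X}
    {ε : ENNReal} (hε : 0 < ε) (hV : IsOpen V) (hVc : IsConnected V) {S : Set X} (hS : S.Finite)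
    (hSV : S ⊆ V) :
    ∃ K, IsCompact K ∧ IsConnected K ∧ S ⊆ K ∧ K ⊆ V ∧ HasForestCover K ε := by
  induction S, hS using Set.Finite.induction_on with
  | empty =>
    obtain ⟨x, hx⟩ := hVc.nonempty
    exact ⟨{x}, isCompact_singleton, isConnected_singleton, by simp, by simpa,
      hasForestCover_singleton x hε⟩
  | @insert a S _ _ ih =>
    obtain ⟨K, hK, hKc, hSK, hKV, hKf⟩ := ih ((subset_insert _ _).trans hSV)
    obtain ⟨K', hK', hK'c, hKK', haK', hK'V, hK'f⟩ :=
      hKf.exists_insert hε hK hKc hV hVc.isPreconnected hKV (hSV (mem_insert a S))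
    exact ⟨K', hK', hK'c, insert_subset haK' (hSK.trans hKK'), hK'V, hK'f⟩

/-- A finite family of relatively open subsets of `K` extends to open sets of the ambient space
with the same nerve and almost the same diameters. -/
theorem HasForestCover.of_subtype {K : Set X} {ε : ENNReal} {ι : Type} [Finite ι] {U : ι → Set K}
    (ho : ∀ i, IsOpen (U i)) (hc : ⋃ i, U i = univ) (hd : ∀ i, Metric.ediam (U i) < ε)
    (ha : (nerveGraph U).IsAcyclic) : HasForestCover K ε := by
  set A : ι → Set X := fun i => (↑) '' U i with hA
  have hδ : ∀ i, ∃ δ : ℝ, 0 < δ ∧ Metric.ediam (Metric.thickening δ (A i)) < ε := by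
    intro i
    obtain ⟨r, hr, hrε⟩ := ENNReal.lt_iff_exists_add_pos_lt.1 (hd i)
    refine ⟨(r / 2 : NNReal), by simpa using hr, (Metric.ediam_thickening_le _).trans_lt ?_⟩
    rwa [hA, isometry_subtype_coe.ediam_image, ← ENNReal.coe_ofNat, ← ENNReal.coe_mul,
      mul_div_cancel₀ _ two_ne_zero]
  choose δ hδ0 hδε using hδ
  -- If `U i`, `U j` are disjoint, then `A i ⊆ K \ A j` and conversely. A common point of `W i` and
  -- `W j` would then be strictly closer to `A i` than to `A j`, and vice versa.
  set W : ι → Set X := fun i => Metric.thickening (δ i) (A i) ∩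
    {x | Metric.infEDist x (A i) < Metric.infEDist x (K \ A i)} with hW
  refine ⟨ι, inferInstance, W, fun i => ?_, ?_, fun i => ?_, ?_⟩
  · exact Metric.isOpen_thickening.inter
      (isOpen_lt Metric.continuous_infEDist Metric.continuous_infEDist)
  · intro x hx
    have : (⟨x, hx⟩ : K) ∈ ⋃ i, U i := hc ▸ mem_univ _
    obtain ⟨i, hi⟩ := mem_iUnion.1 this
    have hxA : x ∈ A i := ⟨_, hi, rfl⟩
    refine mem_iUnion.2 ⟨i, Metric.self_subset_thickening (hδ0 i) _ hxA, ?_⟩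
    simp only [mem_ofPred_eq, Metric.infEDist_zero_of_mem hxA]
    rw [pos_iff_ne_zero, Ne, ← Metric.mem_closure_iff_infEDist_zero]
    obtain ⟨O, hO, hOU⟩ := isOpen_induced_iff.1 (ho i)
    intro hcl
    obtain ⟨y, hyO, hyK, hyA⟩ := mem_closure_iff.1 hcl O hO (by
      have : (⟨x, hx⟩ : K) ∈ Subtype.val ⁻¹' O := hOU ▸ hi
      exact this)
    exact hyA ⟨⟨y, hyK⟩, hOU ▸ hyO, rfl⟩
  · exact lt_of_le_of_lt (Metric.ediam_mono inter_subset_left) (hδε i)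
  · refine ha.anti ?_
    rintro i j ⟨hij, x, ⟨-, hxi⟩, -, hxj⟩
    refine ⟨hij, ?_⟩
    by_contra hemp
    have hsub : ∀ i j, ¬ (U i ∩ U j).Nonempty → A i ⊆ K \ A j := by
      rintro i j hne _ ⟨y, hy, rfl⟩
      refine ⟨y.2, ?_⟩
      rintro ⟨y', hy', hyy⟩
      exact hne ⟨y, hy, Subtype.ext hyy ▸ hy'⟩
    have h1 := Metric.infEDist_anti (x := x) (hsub i j hemp)
    have h2 := Metric.infEDist_anti (x := x) (hsub j i (by rwa [inter_comm]))
    exact lt_irrefl _ (((hxi.trans_le h2).trans hxj).trans_le h1)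

theorem HasForestCover.exists_isTree {K : Set X} {ε : ENNReal} (h : HasForestCover K ε)
    (hK : IsConnected K) : ∃ (n : ℕ) (U : Fin n → Set K), (∀ i, IsOpen (U i)) ∧
      (⋃ i, U i) = univ ∧ (∀ i, Metric.ediam (U i) < ε) ∧ (nerveGraph U).IsTree := by
  obtain ⟨ι, _, U, hUo, hKU, hUε, hUa⟩ := h
  -- Members missing `K` would have empty trace and be isolated vertices.
  obtain ⟨n, ⟨e⟩⟩ := Finite.exists_equiv_fin {i // (U i ∩ K).Nonempty}
  have := isConnected_iff_connectedSpace.1 hK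
  set W : Fin n → Set K := fun k => (↑) ⁻¹' U (e.symm k) with hW
  have hWo : ∀ k, IsOpen (W k) := fun k => (hUo _).preimage continuous_subtype_val
  have hWc : ⋃ k, W k = univ := by
    refine eq_univ_of_forall fun x => ?_
    obtain ⟨i, hi⟩ := mem_iUnion.1 (hKU x.2)
    refine mem_iUnion.2 ⟨e ⟨i, x, hi, x.2⟩, ?_⟩
    simpa [hW] using hi
  refine ⟨n, W, hWo, hWc, fun k => ?_, ?_⟩
  · refine lt_of_le_of_lt ?_ (hUε (e.symm k))
    rw [← isometry_subtype_coe.ediam_image]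
    exact Metric.ediam_mono (image_preimage_subset _ _)
  · have hpre : (nerveGraph W).Preconnected := by
      refine preconnected_nerveGraph hWo (fun k => ?_) hWc
      obtain ⟨x, hxU, hxK⟩ := (e.symm k).2
      exact ⟨⟨x, hxK⟩, hxU⟩
    obtain ⟨x⟩ : Nonempty K := inferInstance
    obtain ⟨k, -⟩ := mem_iUnion.1 (hWc ▸ mem_univ x : x ∈ ⋃ k, W k)
    have : Nonempty (Fin n) := ⟨k⟩
    refine ⟨⟨hpre⟩, hUa.comap ⟨fun k => (e.symm k).1, ?_⟩
      (Subtype.val_injective.comp e.symm.injective)⟩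
    rintro a b ⟨hab, y, hya, hyb⟩
    exact ⟨fun h => hab (e.symm.injective (Subtype.ext h)), y, hya, hyb⟩

theorem isTreeLike_iff_forall_hasForestCover {K : Set X} (hK : IsConnected K) :
    IsTreeLike K ↔ ∀ n : ℕ, HasForestCover K (ENNReal.ofReal (1 / (n + 1))) := by
  constructor
  · intro h n
    obtain ⟨m, U, ho, hc, hd, ht⟩ := h (1 / (n + 1)) Nat.one_div_pos_of_nat
    exact .of_subtype ho hc hd ht.isAcyclic
  · intro h ε hε
    obtain ⟨n, hn⟩ := exists_nat_one_div_lt hε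
    obtain ⟨m, U, ho, hc, hd, ht⟩ := (h n).exists_isTree hK
    exact ⟨m, U, ho, hc, fun i => (hd i).trans_le (ENNReal.ofReal_le_ofReal hn.le), ht⟩

end ForestCover

/-! ### Topology of the hyperspace -/

section Hyperspace

/-- A disconnected `K` splits between disjoint open sets `O` and `O'`. Lying in their union and
meeting both is a Vietoris-open condition that excludes connectedness. -/
theorem isClosed_setOf_isConnected {X : Type*} [TopologicalSpace X] [T2Space X] :
    IsClosed {K : NonemptyCompacts X | IsConnected (K : Set X)} := by
  rw [← isOpen_compl_iff, isOpen_iff_mem_nhds]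
  intro K hK
  have hK' : ¬ IsPreconnected (K : Set X) := fun h => hK ⟨K.nonempty, h⟩
  rw [isPreconnected_iff_subset_of_fully_disjoint_closed K.isCompact.isClosed] at hK'
  push Not at hK'
  obtain ⟨u, v, hu, hv, hKuv, huv, hKu, hKv⟩ := hK'
  have hd : Disjoint ((K : Set X) ∩ u) ((K : Set X) ∩ v) :=
    huv.mono inter_subset_right inter_subset_right
  obtain ⟨O, O', hO, hO', hKO, hKO', hOO'⟩ :=
    SeparatedNhds.of_isCompact_isCompact (K.isCompact.inter_right hu) (K.isCompact.inter_right hv) hd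
  obtain ⟨a, haK, hau⟩ := not_subset.1 hKu
  obtain ⟨b, hbK, hbv⟩ := not_subset.1 hKv
  have h1 := (NonemptyCompacts.isOpen_subsets_of_isOpen (hO.union hO')).mem_nhds
    (show (K : Set X) ⊆ O ∪ O' from fun x hx =>
      (hKuv hx).imp (fun h => hKO ⟨hx, h⟩) (fun h => hKO' ⟨hx, h⟩))
  have h2 := (NonemptyCompacts.isOpen_inter_nonempty_of_isOpen hO).mem_nhds
    (show ((K : Set X) ∩ O).Nonempty from ⟨b, hbK, hKO ⟨hbK, (hKuv hbK).resolve_right hbv⟩⟩)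
  have h3 := (NonemptyCompacts.isOpen_inter_nonempty_of_isOpen hO').mem_nhds
    (show ((K : Set X) ∩ O').Nonempty from ⟨a, haK, hKO' ⟨haK, (hKuv haK).resolve_left hau⟩⟩)
  filter_upwards [h1, h2, h3] with F hF1 hF2 hF3 hFc
  obtain ⟨x, hxF, hxO'⟩ := hF3
  exact Set.disjoint_left.1 hOO'
    (hFc.isPreconnected.subset_left_of_subset_union hO hO' hOO' hF1 hF2 hxF) hxO'

variable {X : Type*} [MetricSpace X]

theorem isOpen_setOf_hasForestCover (ε : ENNReal) :
    IsOpen {K : Subcontinua X | HasForestCover (K.1 : Set X) ε} := by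
  rw [isOpen_iff_mem_nhds]
  rintro K ⟨ι, hι, U, hUo, hKU, hU⟩
  have := ((NonemptyCompacts.isOpen_subsets_of_isOpen (isOpen_iUnion hUo)).preimage
    continuous_subtype_val).mem_nhds (show K ∈ _ from hKU)
  filter_upwards [this] with F hF
  exact ⟨ι, hι, U, hUo, hF, hU⟩

theorem dense_setOf_hasForestCover [CompactSpace X] [LocallyConnectedSpace X] {ε : ENNReal}
    (hε : 0 < ε) : Dense {K : Subcontinua X | HasForestCover (K.1 : Set X) ε} := by
  refine (NonemptyCompacts.isTopologicalBasis.isInducing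
    (IsInducing.subtypeVal (t := {K : NonemptyCompacts X | IsConnected (K : Set X)}))).dense_iff.2
    ?_
  rintro _ ⟨_, ⟨u, ⟨hu, -, huo⟩, rfl⟩, rfl⟩ ⟨K, hKu, hKU⟩
  obtain ⟨x, hx⟩ := K.2.nonempty
  have hxu := hKu hx
  -- Local connectedness makes this component open; it contains `K`, hence a point of `K` in each
  -- member of `u`.
  set V := connectedComponentIn (⋃₀ u) x
  have hKV : (K.1 : Set X) ⊆ V := K.2.isPreconnected.subset_connectedComponentIn hx hKu
  have : Nonempty X := ⟨x⟩
  choose! f hf using hKU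
  obtain ⟨L, hL, hLc, hSL, hLV, hLf⟩ := exists_continuum_hasForestCover hε
    (isOpen_sUnion huo).connectedComponentIn (isConnected_connectedComponentIn_iff.2 hxu)
    (hu.image f) (image_subset_iff.2 fun U hU => hKV (hf U hU).1)
  exact ⟨⟨⟨⟨L, hL⟩, hLc.nonempty⟩, hLc⟩, ⟨hLV.trans (connectedComponentIn_subset _ _),
    fun U hU => ⟨f U, hSL (mem_image_of_mem f hU), (hf U hU).2⟩⟩, hLf⟩

end Hyperspace

theorem mainTheorem6 (X : Type*) [MetricSpace X] [CompactSpace X] [ConnectedSpace X]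
    [LocallyConnectedSpace X] :
    {K : Subcontinua X | IsTreeLike ((K : TopologicalSpace.NonemptyCompacts X) : Set X)} ∈
        residual (Subcontinua X) ∧
      IsGδ {K : Subcontinua X | IsTreeLike ((K : TopologicalSpace.NonemptyCompacts X) : Set X)} ∧
      Dense {K : Subcontinua X | IsTreeLike ((K : TopologicalSpace.NonemptyCompacts X) : Set X)} := by
  -- Compactness supplies the Baire property used for `hD`.
  have : CompactSpace (Subcontinua X) :=
    isCompact_iff_compactSpace.1 (isClosed_setOf_isConnected (X := X)).isCompact
  have heq : {K : Subcontinua X | IsTreeLike ((K : TopologicalSpace.NonemptyCompacts X) : Set X)} =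
      ⋂ n : ℕ, {K : Subcontinua X | HasForestCover (K.1 : Set X) (ENNReal.ofReal (1 / (n + 1)))} := by
    ext K
    simpa using isTreeLike_iff_forall_hasForestCover K.2
  have hG : IsGδ {K : Subcontinua X |
      IsTreeLike ((K : TopologicalSpace.NonemptyCompacts X) : Set X)} := by
    rw [heq]
    exact .iInter_of_isOpen fun n => isOpen_setOf_hasForestCover _
  have hD : Dense {K : Subcontinua X |
      IsTreeLike ((K : TopologicalSpace.NonemptyCompacts X) : Set X)} := by
    rw [heq]
    exact dense_iInter_of_isOpen (fun n => isOpen_setOf_hasForestCover _)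
      fun n => dense_setOf_hasForestCover (ENNReal.ofReal_pos.2 Nat.one_div_pos_of_nat)
  exact ⟨residual_of_dense_Gδ hG hD, hG, hD⟩
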